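/- All digraphs are finite and have no loops. A digraph is strongly connected if it has at least one vertex and for every pair of vertices $u,v$ there is a dipath from $u$ to $v$. The adjacency matrix $\mathcal A(\Gamma)$ has $(u,v)$ entry $1$ if $(u,v)$ is an arc and $0$ otherwise; the distance matrix $\mathcal D(\Gamma)$ of a strongly connected digraph has as $(u,v)$ entry the length of a shortest dipath from $u$ to $v$. The lexicographic product $\Gamma\circ\Gamma'$ has vertex set $V(\Gamma)\times V(\Gamma')$, with an arc from $(x,x')$ to $(y,y')$ if and only if $(x,y)$ is an arc of $\Gamma$, or $x=y$ and $(x',y')$ is an arc of $\Gamma'$. For a square matrix $M$, $\operatorname{spec}(M)$ is the multiset of its complex eigenvalues with algebraic multiplicity, $ES_M(z)$ is the complex eigenspace of $M$ for $z$ (zero if $z$ is not an eigenvalue), and $\operatorname{gmult}_M(z)=\dim ES_M(z)$. Write $\operatorname{spec}_{\mathcal A}(\Gamma)=\operatorname{spec}(\mathcal A(\Gamma))$, $\operatorname{spec}_{\mathcal D}(\Gamma)=\operatorname{spec}(\mathcal D(\Gamma))$, and let $\mathbf 1$ be the all ones vector. **Theorem.** Let $\Gamma$ and $\Gamma'$ be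 strongly connected digraphs of orders $n$ and $n'$ such that every vertex $v$ of $\Gamma$ is incident with a doubly directed arc (that is, $(v,w)$ and $(w,v)$ are both arcs for some $w$) and every vertex of $\Gamma'$ has out-degree $r'$. Then $\Gamma\circ\Gamma'$ is strongly connected and $r'\in\operatorname{spec}_{\mathcal A}(\Gamma')$. Let $\operatorname{spec}_{\mathcal D}(\Gamma)=\{\partial_1,\dots,\partial_n\}$ and $\operatorname{spec}_{\mathcal A}(\Gamma')=\{r',\alpha'_2,\dots,\alpha'_{n'}\}$. Then, as multisets, \[ \operatorname{spec}_{\mathcal D}(\Gamma\circ\Gamma')=\{n'\partial_i+2n'-2-r' : i=1,\dots,n\}\cup\{(-(\alpha'_j+2))^{(n)} : j=2,\dots,n'\}, \] where the union adds multiplicities and the superscript $(n)$ means that each listed element is repeated $n$ times. Moreover, for $z\in\mathbb C$ put $\tilde z=\frac{z-2n'+2+r'}{n'}$, $g=\operatorname{gmult}_{\mathcal D(\Gamma)}(\tilde z)$ and $g'=\operatorname{gmult}_{\mathcal A(\Gamma')}(-z-2)$, and let $S'=\operatorname{spec}_{\mathcal A}(\Gamma')\setminus\{r'\}$ be the set of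 eigenvalues of $\mathcal A(\Gamma')$ other than $r'$. Then \[ \operatorname{gmult}_{\mathcal D(\Gamma\circ\Gamma')}(z)= \begin{cases} g & \text{if } -z-2\notin S',\ \tilde z\in\operatorname{spec}_{\mathcal D}(\Gamma);\\ ng' & \text{if } -z-2\in S',\ \tilde z\notin\operatorname{spec}_{\mathcal D}(\Gamma);\\ ng'+g & \text{if } -z-2\in S',\ \tilde z\in\operatorname{spec}_{\mathcal D}(\Gamma),\ ES_{\mathcal A(\Gamma')}(-z-2)\perp\mathbf 1;\\ ng' & \text{if } -z-2\in S',\ \tilde z\in\operatorname{spec}_{\mathcal D}(\Gamma),\ ES_{\mathcal A(\Gamma')}(-z-2)\not\perp\mathbf 1;\\ 0 & \text{otherwise.} \end{cases} \] -/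

import Mathlib

noncomputable section

namespace Digraph

variable {V W : Type*}

/-- No arc has equal endpoints. (Mathlib's `Digraph` is an arbitrary relation.) -/
def Loopless (Γ : Digraph V) : Prop := ∀ v, ¬ Γ.Adj v v

/-- `Γ.HasDipath u v k`: there is a sequence of `k` consecutive arcs of `Γ` leading from `u`
to `v`. -/
inductive HasDipath (Γ : Digraph V) : V → V → ℕ → Prop
  | nil (v : V) : HasDipath Γ v v 0
  | cons {u w v : V} {k : ℕ} (h : Γ.Adj u w) (p : HasDipath Γ w v k) : HasDipath Γ u v (k + 1)

/-- Every vertex can be reached from every vertex along a dipath; the digraph with no vertices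
is excluded. -/
def StronglyConnected (Γ : Digraph V) : Prop :=
  Nonempty V ∧ ∀ u v, ∃ k, Γ.HasDipath u v k

/-- The length of a shortest dipath from `u` to `v` (meaningful if there is such a dipath). -/
def dist (Γ : Digraph V) (u v : V) : ℕ := sInf {k | Γ.HasDipath u v k}

open Classical in
/-- The number of arcs starting at `v`. -/
def outDegree [Fintype V] (Γ : Digraph V) (v : V) : ℕ :=
  (Finset.univ.filter fun w => Γ.Adj v w).card

/-- `v` is an endpoint of a pair of opposite arcs. -/
def OnDoublyDirectedArc (Γ : Digraph V) (v : V) : Prop :=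
  ∃ w, Γ.Adj v w ∧ Γ.Adj w v

/-- The lexicographic product of `Γ` and `Γ'`. -/
def lexProduct (Γ : Digraph V) (Γ' : Digraph W) : Digraph (V × W) where
  Adj p q := Γ.Adj p.1 q.1 ∨ (p.1 = q.1 ∧ Γ'.Adj p.2 q.2)

open Classical in
/-- The adjacency matrix, with its entries regarded as complex numbers. -/
def adjMatrix (Γ : Digraph V) : Matrix V V ℂ :=
  Matrix.of fun u v => if Γ.Adj u v then 1 else 0

/-- The distance matrix, with its entries regarded as complex numbers. -/
def distMatrix (Γ : Digraph V) : Matrix V V ℂ :=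
  Matrix.of fun u v => (Γ.dist u v : ℂ)

end Digraph

namespace Matrix

variable {V : Type*} [Fintype V] [DecidableEq V]

/-- The spectrum as a multiset: the complex eigenvalues, each repeated according to its
algebraic multiplicity. -/
def specMultiset (M : Matrix V V ℂ) : Multiset ℂ := M.charpoly.roots

/-- The eigenspace of `M` relative to `z`; it is zero if `z` is not an eigenvalue. -/
def eigSpace (M : Matrix V V ℂ) (z : ℂ) : Submodule ℂ (V → ℂ) :=
  Module.End.eigenspace (Matrix.toLin' M) z

/-- The geometric multiplicity of `z` with respect to `M`. -/
def gmult (M : Matrix V V ℂ) (z : ℂ) : ℕ := Module.finrank ℂ (M.eigSpace z)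

/-- The eigenspace of `M` relative to `z` is orthogonal to the all ones vector. -/
def EigSpacePerpOnes (M : Matrix V V ℂ) (z : ℂ) : Prop :=
  ∀ v ∈ M.eigSpace z, v ⬝ᵥ (1 : V → ℂ) = 0

end Matrix

end

/-! ### Distances in the lexicographic product -/

namespace Digraph

variable {V W : Type*} {Γ : Digraph V} {Γ' : Digraph W}

/-! Between different fibres, distances in the product are those of `Γ`. Inside a fibre they are 0,
1 or 2, because a doubly directed arc gives a way out and back. With E = D + 2I this reads D(Γ∘Γ') =
E ⊗ J − I ⊗ (A' + 2I) (`distMatrix_lexProduct`).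

Since A' has constant row sums r', the factor J meets only the eigenvector 1 of A'. The identity
det(1 − PQ) = det(1 − QP) then splits the characteristic polynomial (`specMultiset_kronecker_sub`).

With μ = −z − 2, an eigenvector f satisfies (A' − μ) f(x,·) = c_x 1 on each fibre, where c = Es and
s is the vector of fibre sums. If μ ≠ r', then f(x,·) = c_x/(r' − μ) 1 + h_x with h_x in the
μ-eigenspace of A'. Consistency of s is a linear condition, and its rank depends on whether that
eigenspace is orthogonal to 1. If μ = r', a maximum principle makes f constant on fibres
(`gmult_kronecker_sub_of_eq`). -/

theorem hasDipath_zero_iff {u v : V} : Γ.HasDipath u v 0 ↔ u = v :=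
  ⟨fun h => by cases h; rfl, fun h => h ▸ .nil u⟩

theorem hasDipath_one_iff {u v : V} : Γ.HasDipath u v 1 ↔ Γ.Adj u v := by
  refine ⟨fun h => ?_, fun h => .cons h (.nil v)⟩
  cases h with
  | cons h p => rwa [← hasDipath_zero_iff.1 p]

theorem dist_le {u v : V} {k : ℕ} (h : Γ.HasDipath u v k) : Γ.dist u v ≤ k := Nat.sInf_le h

theorem hasDipath_dist {u v : V} (h : ∃ k, Γ.HasDipath u v k) : Γ.HasDipath u v (Γ.dist u v) :=
  Nat.sInf_mem h

theorem dist_self (v : V) : Γ.dist v v = 0 := Nat.le_zero.1 (dist_le (.nil v))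

/-- Arcs inside a fibre collapse under projection, so length can only drop. -/
theorem HasDipath.lexProduct_fst {p q : V × W} {k : ℕ} (h : (Γ.lexProduct Γ').HasDipath p q k) :
    ∃ j ≤ k, Γ.HasDipath p.1 q.1 j := by
  induction h with
  | nil v => exact ⟨0, le_rfl, .nil _⟩
  | cons h _ ih =>
    obtain ⟨j, hj, hp⟩ := ih
    rcases h with h | ⟨h, -⟩
    · exact ⟨j + 1, by omega, .cons h hp⟩
    · exact ⟨j, by omega, h ▸ hp⟩

/-- An arc between fibres may change the second coordinate at will, so one such arc suffices to
reach `b`. -/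
theorem HasDipath.lexProduct_lift {u v : V} {k : ℕ} (h : Γ.HasDipath u v k) (hk : k ≠ 0)
    (a b : W) : (Γ.lexProduct Γ').HasDipath (u, a) (v, b) k := by
  induction h generalizing a with
  | nil v => exact absurd rfl hk
  | @cons u w v k h p ih =>
    cases k with
    | zero =>
      obtain rfl := hasDipath_zero_iff.1 p
      exact hasDipath_one_iff.2 (Or.inl h)
    | succ k => exact .cons (Or.inl h) (ih k.succ_ne_zero b)

theorem OnDoublyDirectedArc.hasDipath_lexProduct {v : V} (h : Γ.OnDoublyDirectedArc v)
    (a b : W) : (Γ.lexProduct Γ').HasDipath (v, a) (v, b) 2 := by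
  obtain ⟨w, h₁, h₂⟩ := h
  exact HasDipath.lexProduct_lift (.cons h₁ (.cons h₂ (.nil v))) two_ne_zero a b

theorem StronglyConnected.lexProduct (hΓ : Γ.StronglyConnected) (hW : Nonempty W)
    (hdd : ∀ v, Γ.OnDoublyDirectedArc v) : (Γ.lexProduct Γ').StronglyConnected := by
  obtain ⟨hV, hΓ⟩ := hΓ
  refine ⟨inferInstance, fun ⟨u, a⟩ ⟨v, b⟩ => ?_⟩
  obtain ⟨k, hk⟩ := hΓ u v
  rcases eq_or_ne k 0 with rfl | h0
  · obtain rfl := hasDipath_zero_iff.1 hk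
    exact ⟨2, (hdd u).hasDipath_lexProduct a b⟩
  · exact ⟨k, hk.lexProduct_lift h0 a b⟩

theorem dist_lexProduct_of_ne (hΓ : Γ.StronglyConnected) {u v : V} (huv : u ≠ v) (a b : W) :
    (Γ.lexProduct Γ').dist (u, a) (v, b) = Γ.dist u v := by
  have h := hasDipath_dist (hΓ.2 u v)
  have h0 : Γ.dist u v ≠ 0 := fun h0 => huv (hasDipath_zero_iff.1 (h0 ▸ h))
  have hl := h.lexProduct_lift (Γ' := Γ') h0 a b
  obtain ⟨j, hj, hp⟩ := (hasDipath_dist ⟨_, hl⟩).lexProduct_fst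
  exact le_antisymm (dist_le hl) ((dist_le hp).trans hj)

open Classical in
theorem dist_lexProduct_same (hΓ : Γ.Loopless) {v : V} (hv : Γ.OnDoublyDirectedArc v) (a b : W) :
    (Γ.lexProduct Γ').dist (v, a) (v, b) =
      if a = b then 0 else if Γ'.Adj a b then 1 else 2 := by
  split_ifs with hab h
  · rw [hab, dist_self]
  all_goals
    have h2 := hv.hasDipath_lexProduct (Γ' := Γ') a b
    have hd := hasDipath_dist ⟨_, h2⟩
    have hle := dist_le h2
    generalize hk : (Γ.lexProduct Γ').dist (v, a) (v, b) = k at *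
    have hk0 : k ≠ 0 := by
      rintro rfl
      exact hab (congrArg Prod.snd (hasDipath_zero_iff.1 hd))
  · have : k ≤ 1 := hk ▸ dist_le (hasDipath_one_iff.2 (Or.inr ⟨rfl, h⟩))
    omega
  · have hk1 : k ≠ 1 := by
      rintro rfl
      rcases hasDipath_one_iff.1 hd with h' | h'
      · exact hΓ v h'
      · exact h h'.2
    omega

open scoped Kronecker in
theorem distMatrix_lexProduct [DecidableEq V] [DecidableEq W]
    (hΓ : Γ.Loopless) (hΓ' : Γ'.Loopless) (hconn : Γ.StronglyConnected)
    (hdd : ∀ v, Γ.OnDoublyDirectedArc v) :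
    (Γ.lexProduct Γ').distMatrix =
      (Γ.distMatrix + 2) ⊗ₖ (Matrix.of fun _ _ => (1 : ℂ)) -
        (1 : Matrix V V ℂ) ⊗ₖ (Γ'.adjMatrix + 2) := by
  ext ⟨u, a⟩ ⟨v, b⟩
  have h2V : (2 : Matrix V V ℂ) u v = if u = v then 2 else 0 := Matrix.diagonal_apply ..
  have h2W : (2 : Matrix W W ℂ) a b = if a = b then 2 else 0 := Matrix.diagonal_apply ..
  simp only [Matrix.sub_apply, Matrix.kroneckerMap_apply, Matrix.add_apply, Matrix.of_apply,
    distMatrix, adjMatrix, Matrix.one_apply, h2V, h2W]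
  rcases eq_or_ne u v with rfl | huv
  · rw [dist_lexProduct_same hΓ (hdd u), dist_self]
    rcases eq_or_ne a b with rfl | hab
    · simp [hΓ' a]
    · by_cases h : Γ'.Adj a b <;> simp [hab, h]; norm_num
  · simp [dist_lexProduct_of_ne hconn huv, huv]

/-! ### Constant out-degree and the maximum principle -/

open Classical in
theorem sum_adjMatrix_mul [Fintype W] (a : W) (f : W → ℂ) :
    ∑ b, Γ'.adjMatrix a b * f b = ∑ b with Γ'.Adj a b, f b := by
  simp [adjMatrix, Finset.sum_filter]

theorem sum_adjMatrix [Fintype W] {r : ℕ} (hr : ∀ w, Γ'.outDegree w = r) (a : W) :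
    ∑ b, Γ'.adjMatrix a b = r := by
  have := sum_adjMatrix_mul (Γ' := Γ') a 1
  simp only [Pi.one_apply, mul_one, Finset.sum_const, nsmul_eq_mul] at this
  rw [this, ← hr a]
  rfl

open Classical in
/-- The maximum principle for digraphs with constant out-degree. -/
theorem eq_of_sum_adj_eq_real [Fintype W] (hconn : Γ'.StronglyConnected) {r : ℕ}
    (hr : ∀ w, Γ'.outDegree w = r) {u : W → ℝ} {c : ℝ} (hc : 0 ≤ c)
    (h : ∀ a, ∑ b with Γ'.Adj a b, u b = r * u a + c) (a b : W) : u a = u b := by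
  obtain ⟨hW, hconn⟩ := hconn
  obtain ⟨m, hm⟩ := Finite.exists_max u
  have step : ∀ v w, Γ'.Adj v w → u v = u m → u w = u m := by
    intro v w hvw hv
    have hnn : ∀ x ∈ Finset.univ.filter (Γ'.Adj v), 0 ≤ u m - u x := fun x _ => by
      linarith [hm x]
    have hs : ∑ x with Γ'.Adj v x, (u m - u x) = -c := by
      have hcard : (Finset.univ.filter (Γ'.Adj v)).card = r := hr v
      rw [Finset.sum_sub_distrib, h, Finset.sum_const, hcard, hv, nsmul_eq_mul]
      ring
    -- The terms are nonnegative while their sum is −c ≤ 0, so all vanish and the maximum spreads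
    -- along arcs.
    have h0 : ∑ x with Γ'.Adj v x, (u m - u x) = 0 :=
      le_antisymm (by linarith) (Finset.sum_nonneg hnn)
    have := (Finset.sum_eq_zero_iff_of_nonneg hnn).1 h0 w (by simpa using hvw)
    linarith
  have all : ∀ w, u w = u m := by
    intro w
    obtain ⟨k, hk⟩ := hconn m w
    have : ∀ x y k, Γ'.HasDipath x y k → u x = u m → u y = u m := by
      intro x y k p
      induction p with
      | nil v => exact id
      | cons h _ ih => exact fun hx => ih (step _ _ h hx)
    exact this _ _ _ hk rfl
  rw [all a, all b]

open Classical in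
theorem eq_of_sum_adj_eq_real' [Fintype W] (hconn : Γ'.StronglyConnected) {r : ℕ}
    (hr : ∀ w, Γ'.outDegree w = r) {u : W → ℝ} {c : ℝ}
    (h : ∀ a, ∑ b with Γ'.Adj a b, u b = r * u a + c) (a b : W) : u a = u b := by
  rcases le_total 0 c with hc | hc
  · exact eq_of_sum_adj_eq_real hconn hr hc h a b
  · refine neg_injective (eq_of_sum_adj_eq_real hconn hr (u := fun w => -u w) (c := -c)
      (by linarith) (fun a => ?_) a b)
    rw [Finset.sum_neg_distrib, h]
    ring

/-- The system is real, so real and imaginary parts separate. The inhomogeneous term `c` is what the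
other fibres contribute to the eigenvector equation. -/
theorem eq_of_sum_adjMatrix_mul_eq [Fintype W] (hconn : Γ'.StronglyConnected) {r : ℕ}
    (hr : ∀ w, Γ'.outDegree w = r) {u : W → ℂ} {c : ℂ}
    (h : ∀ a, ∑ b, Γ'.adjMatrix a b * u b = r * u a + c) (a b : W) : u a = u b := by
  classical
  simp only [sum_adjMatrix_mul] at h
  refine Complex.ext
    (eq_of_sum_adj_eq_real' hconn hr (u := fun w => (u w).re) (c := c.re) (fun a => ?_) a b)
    (eq_of_sum_adj_eq_real' hconn hr (u := fun w => (u w).im) (c := c.im) (fun a => ?_) a b)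
  · simpa using congrArg Complex.re (h a)
  · simpa using congrArg Complex.im (h a)

end Digraph

/-! ### The spectrum of the Kronecker expression -/

open scoped Kronecker

/-- Two polynomials agreeing off one point are equal. The exempt point leaves room for dividing by a
factor that vanishes there. -/
theorem Multiset.eq_of_prod_sub_eq {s t : Multiset ℂ} (c : ℂ)
    (h : ∀ x ≠ c, (s.map fun a => x - a).prod = (t.map fun a => x - a).prod) : s = t := by
  have key : (s.map fun a => Polynomial.X - Polynomial.C a).prod =
      (t.map fun a => Polynomial.X - Polynomial.C a).prod := by
    refine Polynomial.eq_of_infinite_eval_eq _ _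
      (Set.Infinite.mono (s := {c}ᶜ) (fun x hx => ?_) (Set.finite_singleton c).infinite_compl)
    simpa [Polynomial.eval_multiset_prod, Multiset.map_map] using h x hx
  rw [← Polynomial.roots_multiset_prod_X_sub_C s, key, Polynomial.roots_multiset_prod_X_sub_C]

namespace Matrix

variable {V W : Type*} [Fintype V] [DecidableEq V] [Fintype W] [DecidableEq W]

theorem card_specMultiset (M : Matrix V V ℂ) : M.specMultiset.card = Fintype.card V := by
  rw [specMultiset, Polynomial.splits_iff_card_roots.1 (IsAlgClosed.splits _),
    charpoly_natDegree_eq_dim]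

theorem det_scalar_sub (M : Matrix V V ℂ) (s : ℂ) :
    (scalar V s - M).det = (M.specMultiset.map fun a => s - a).prod := by
  rw [← eval_charpoly,
    (IsAlgClosed.splits _).eval_eq_prod_roots_of_monic M.charpoly_monic, specMultiset]

theorem det_scalar_add_smul (M : Matrix V V ℂ) (s : ℂ) {k : ℂ} (hk : k ≠ 0) :
    (scalar V s + k • M).det = (M.specMultiset.map fun a => s + k * a).prod := by
  have h : scalar V s + k • M = (-k) • (scalar V (-s / k) - M) := by
    ext i j
    simp only [add_apply, smul_apply, sub_apply, scalar_apply, diagonal_apply, smul_eq_mul]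
    split_ifs <;> field_simp <;> ring
  rw [h, det_smul, det_scalar_sub, ← card_specMultiset M, ← Multiset.prod_replicate,
    ← Multiset.map_const', ← Multiset.prod_map_mul]
  congr 2 with a
  field_simp
  ring

/-- E ⊗ J factors as PQ through `V`. The columns of P are constant on fibres, hence eigenvectors of
I ⊗ (t + 2 + A) for t + 2 + r, which can therefore be pulled out as a left factor. -/
theorem det_scalar_sub_kronecker (E : Matrix V V ℂ) (A : Matrix W W ℂ) {t r : ℂ}
    (hA : ∀ a, ∑ b, A a b = r) (ht : t + 2 + r ≠ 0) :
    (scalar (V × W) t - (E ⊗ₖ (of fun _ _ => (1 : ℂ)) - (1 : Matrix V V ℂ) ⊗ₖ (A + 2))).det *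
        (t + 2 + r) ^ Fintype.card V =
      (scalar W (t + 2) + A).det ^ Fintype.card V *
        (scalar V (t + 2 + r) - (Fintype.card W : ℂ) • E).det := by
  let P : Matrix (V × W) V ℂ := of fun p y => E p.1 y
  let Q : Matrix V (V × W) ℂ := of fun y p => if y = p.1 then 1 else 0
  have hQP : Q * P = (Fintype.card W : ℂ) • E := by
    ext x y
    simp [P, Q, mul_apply, Fintype.sum_prod_type]
  have hPQ : P * Q = E ⊗ₖ (of fun _ _ => (1 : ℂ)) := by
    ext ⟨x, a⟩ ⟨y, b⟩
    simp [P, Q, mul_apply]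
  have hCP : ((1 : Matrix V V ℂ) ⊗ₖ (scalar W (t + 2) + A)) * P = (t + 2 + r) • P := by
    ext ⟨x, a⟩ y
    simp [P, mul_apply, Fintype.sum_prod_type, one_apply, ← Finset.sum_mul, Finset.sum_add_distrib,
      diagonal_apply, hA]
  have hdec : scalar (V × W) t -
      (E ⊗ₖ (of fun _ _ => (1 : ℂ)) - (1 : Matrix V V ℂ) ⊗ₖ (A + 2)) =
      ((1 : Matrix V V ℂ) ⊗ₖ (scalar W (t + 2) + A)) * (1 - ((t + 2 + r)⁻¹ • P) * Q) := by
    rw [mul_sub, mul_one, ← Matrix.mul_assoc, Matrix.mul_smul, hCP, inv_smul_smul₀ ht, hPQ]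
    ext ⟨x, a⟩ ⟨y, b⟩
    have h2 : (2 : Matrix W W ℂ) a b = if a = b then 2 else 0 := diagonal_apply ..
    simp only [sub_apply, kroneckerMap_apply, add_apply, scalar_apply, diagonal_apply, h2,
      one_apply, Prod.mk.injEq]
    by_cases hx : x = y <;> by_cases ha : a = b <;> simp [hx, ha]
    ring
  have hfac : scalar V (t + 2 + r) - (Fintype.card W : ℂ) • E =
      (t + 2 + r) • (1 - Q * ((t + 2 + r)⁻¹ • P)) := by
    rw [Matrix.mul_smul, hQP, smul_sub, smul_inv_smul₀ ht, scalar_apply, smul_one_eq_diagonal]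
  rw [hdec, det_mul, det_kronecker, det_one, one_pow, one_mul, det_one_sub_mul_comm, hfac, det_smul]
  ring

theorem specMultiset_kronecker_sub [Nonempty W] (D : Matrix V V ℂ) (A : Matrix W W ℂ) {r : ℂ}
    (hA : ∀ a, ∑ b, A a b = r) (hr : r ∈ A.specMultiset) :
    ((D + 2) ⊗ₖ (of fun _ _ => (1 : ℂ)) - (1 : Matrix V V ℂ) ⊗ₖ (A + 2)).specMultiset =
      D.specMultiset.map
          (fun d => (Fintype.card W : ℂ) * d + 2 * (Fintype.card W : ℂ) - 2 - r) +
        Fintype.card V • (A.specMultiset.erase r).map (fun a => -(a + 2)) := by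
  have hW : (Fintype.card W : ℂ) ≠ 0 := Nat.cast_ne_zero.2 Fintype.card_ne_zero
  refine Multiset.eq_of_prod_sub_eq (-(r + 2)) fun t ht => ?_
  have ht' : t + 2 + r ≠ 0 := fun h => ht (by linear_combination h)
  refine mul_right_cancel₀ (pow_ne_zero (Fintype.card V) ht') ?_
  -- Its factor t + 2 + r, raised to the power |V|, cancels the power introduced above.
  have h1 : (scalar W (t + 2) + A).det =
      (t + 2 + r) * ((A.specMultiset.erase r).map fun a => t + 2 + a).prod := by
    have := det_scalar_add_smul A (t + 2) one_ne_zero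
    rw [one_smul] at this
    rw [this, ← Multiset.cons_erase hr]
    simp
  have h2 : scalar V (t + 2 + r) - (Fintype.card W : ℂ) • (D + 2) =
      scalar V (t + 2 + r - 2 * Fintype.card W) + (-(Fintype.card W : ℂ)) • D := by
    ext i j
    have h2 : (2 : Matrix V V ℂ) i j = if i = j then 2 else 0 := diagonal_apply ..
    simp only [sub_apply, add_apply, smul_apply, scalar_apply, diagonal_apply, h2, smul_eq_mul]
    split_ifs <;> ring
  rw [← det_scalar_sub, det_scalar_sub_kronecker _ _ hA ht', h1, h2,
    det_scalar_add_smul _ _ (neg_ne_zero.2 hW), Multiset.map_add, Multiset.prod_add,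
    Multiset.map_nsmul, Multiset.prod_nsmul, Multiset.map_map, Multiset.map_map]
  have e1 : ((fun a => t - a) ∘ fun a : ℂ => -(a + 2)) = fun a => t + 2 + a := by
    funext a
    simp only [Function.comp]
    ring
  have e2 : ((fun a => t - a) ∘
      fun d : ℂ => (Fintype.card W : ℂ) * d + 2 * (Fintype.card W : ℂ) - 2 - r) =
      fun d => t + 2 + r - 2 * Fintype.card W + -(Fintype.card W : ℂ) * d := by
    funext a
    simp only [Function.comp]
    ring
  rw [e1, e2, mul_pow]
  ring

end Matrix

/-! ### Geometric multiplicities -/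

namespace Matrix

variable {V W : Type*} [Fintype V] [DecidableEq V] [Fintype W] [DecidableEq W]

theorem mem_eigSpace {M : Matrix V V ℂ} {z : ℂ} {f : V → ℂ} :
    f ∈ M.eigSpace z ↔ ∀ i, ∑ j, M i j * f j = z * f i := by
  rw [eigSpace, Module.End.mem_eigenspace_iff, funext_iff]
  rfl

theorem mem_specMultiset_iff {M : Matrix V V ℂ} {z : ℂ} :
    z ∈ M.specMultiset ↔ M.eigSpace z ≠ ⊥ := by
  rw [specMultiset, Polynomial.mem_roots M.charpoly_monic.ne_zero, ← charpoly_toLin',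
    ← Module.End.hasEigenvalue_iff_isRoot_charpoly]
  rfl

theorem eigSpace_eq_bot {M : Matrix V V ℂ} {z : ℂ} (h : z ∉ M.specMultiset) :
    M.eigSpace z = ⊥ := by
  simpa [mem_specMultiset_iff] using h

theorem gmult_eq_zero {M : Matrix V V ℂ} {z : ℂ} (h : z ∉ M.specMultiset) : M.gmult z = 0 := by
  rw [gmult, eigSpace_eq_bot h, finrank_bot]

theorem mem_specMultiset_of_sum_eq [Nonempty V] {M : Matrix V V ℂ} {r : ℂ}
    (h : ∀ i, ∑ j, M i j = r) : r ∈ M.specMultiset := by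
  rw [mem_specMultiset_iff]
  refine (Submodule.ne_bot_iff _).2 ⟨1, mem_eigSpace.2 fun i => ?_, one_ne_zero⟩
  simp [h]

/-- Fibres interact only through their sums, by a term constant on each fibre. -/
theorem mem_eigSpace_kronecker_sub {E : Matrix V V ℂ} {A : Matrix W W ℂ} {z : ℂ}
    {f : V × W → ℂ} :
    f ∈ (E ⊗ₖ (of fun _ _ => (1 : ℂ)) - (1 : Matrix V V ℂ) ⊗ₖ (A + 2)).eigSpace z ↔
      ∀ x a, ∑ b, A a b * f (x, b) = (-z - 2) * f (x, a) + ∑ y, E x y * ∑ b, f (y, b) := by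
  rw [mem_eigSpace, Prod.forall]
  refine forall₂_congr fun x a => ?_
  have h2 : ∀ b, (2 : Matrix W W ℂ) a b = if a = b then 2 else 0 := fun b => diagonal_apply ..
  have : ∑ p, (E ⊗ₖ (of fun _ _ => (1 : ℂ)) - (1 : Matrix V V ℂ) ⊗ₖ (A + 2) :
      Matrix (V × W) (V × W) ℂ) (x, a) p * f p =
      ∑ y, E x y * ∑ b, f (y, b) - ∑ b, A a b * f (x, b) - 2 * f (x, a) := by
    simp [Fintype.sum_prod_type, sub_mul, add_mul, one_apply, Finset.sum_add_distrib, h2,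
      Finset.mul_sum, sub_sub]
  rw [this]
  constructor <;> intro h <;> linear_combination -h

/-- The eigenvectors of `E ⊗ J - 1 ⊗ (A + 2)` in terms of their fibre sums `s` and of elements of an
eigenspace of `A`: they are parametrised by the kernel of this map. -/
def fibreSumDefect (E : Matrix V V ℂ) (A : Matrix W W ℂ) (μ α : ℂ) :
    ((V → ℂ) × (V → A.eigSpace μ)) →ₗ[ℂ] (V → ℂ) where
  toFun p x := p.1 x - α * ∑ y, E x y * p.1 y - ∑ a, (p.2 x : W → ℂ) a
  map_add' p q := by
    funext x
    simp [mul_add, Finset.sum_add_distrib]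
    ring
  map_smul' c p := by
    funext x
    simp [Finset.mul_sum, mul_sub, mul_left_comm]

/-- The vector with value `β (E s)(x) + h_x(a)` at `(x, a)`. -/
def ofFibreSum (E : Matrix V V ℂ) (A : Matrix W W ℂ) (μ β : ℂ) :
    ((V → ℂ) × (V → A.eigSpace μ)) →ₗ[ℂ] (V × W → ℂ) where
  toFun p q := β * ∑ y, E q.1 y * p.1 y + (p.2 q.1 : W → ℂ) q.2
  map_add' p q := by
    funext x
    simp [mul_add, Finset.sum_add_distrib]
    ring
  map_smul' c p := by
    funext x
    simp [Finset.mul_sum, mul_add, mul_left_comm]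

theorem gmult_kronecker_sub_eq_finrank_ker {E : Matrix V V ℂ} {A : Matrix W W ℂ} {r z : ℂ}
    (hA : ∀ a, ∑ b, A a b = r) (hz : -z - 2 ≠ r) :
    (E ⊗ₖ (of fun _ _ => (1 : ℂ)) - (1 : Matrix V V ℂ) ⊗ₖ (A + 2)).gmult z =
      Module.finrank ℂ (fibreSumDefect E A (-z - 2) (Fintype.card W / (r - (-z - 2)))).ker := by
  set μ := -z - 2 with hμ
  have hβ : r - μ ≠ 0 := sub_ne_zero.2 hz.symm
  set T := fibreSumDefect E A μ (Fintype.card W / (r - μ)) with hT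
  set Φ := ofFibreSum E A μ (r - μ)⁻¹ with hΦ
  have hT_iff : ∀ p, T p = 0 ↔ ∀ x, ∑ a, Φ p (x, a) = p.1 x := by
    intro p
    rw [funext_iff]
    refine forall_congr' fun x => ?_
    have h1 : ∑ a, Φ p (x, a) =
        Fintype.card W / (r - μ) * ∑ y, E x y * p.1 y + ∑ a, (p.2 x : W → ℂ) a := by
      simp [hΦ, ofFibreSum, Finset.sum_add_distrib, div_eq_mul_inv, mul_assoc]
    have h2 : T p x = p.1 x - Fintype.card W / (r - μ) * ∑ y, E x y * p.1 y -
      ∑ a, (p.2 x : W → ℂ) a := rfl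
    rw [h1, h2, Pi.zero_apply]
    constructor <;> intro h <;> linear_combination -h
  -- On the kernel of T, `s` is recovered as the fibre sums of the image, and then `h` by
  -- subtraction.
  have hinj : Function.Injective (Φ.domRestrict T.ker) := by
    rw [injective_iff_map_eq_zero]
    rintro ⟨⟨s, h⟩, hp⟩ h0
    have h0' : Φ (s, h) = 0 := h0
    have hs : s = 0 := by
      funext x
      have hx := (hT_iff _).1 hp x
      simpa [h0'] using hx.symm
    subst hs
    have hh : h = 0 := by
      funext x
      ext a
      simpa [hΦ, ofFibreSum] using congrFun h0' (x, a)
    subst hh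
    rfl
  have hrange : (Φ.domRestrict T.ker).range =
      (E ⊗ₖ (of fun _ _ => (1 : ℂ)) - (1 : Matrix V V ℂ) ⊗ₖ (A + 2)).eigSpace z := by
    ext f
    rw [LinearMap.mem_range, mem_eigSpace_kronecker_sub, ← hμ]
    constructor
    · rintro ⟨⟨⟨s, h⟩, hp⟩, rfl⟩ x a
      have hsum := (hT_iff _).1 hp
      simp only [LinearMap.domRestrict_apply] at hsum ⊢
      simp only [hsum]
      simp only [hΦ, ofFibreSum, LinearMap.coe_mk, AddHom.coe_mk, mul_add, Finset.sum_add_distrib,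
        ← Finset.sum_mul, hA, mem_eigSpace.1 (h x).2 a]
      field_simp
      ring
    · intro hf
      -- Subtracting the constant particular solution leaves a solution of the homogeneous equation.
      have hmem : ∀ x, (fun a => f (x, a) - (r - μ)⁻¹ * ∑ y, E x y * ∑ b, f (y, b)) ∈
          A.eigSpace μ := by
        intro x
        rw [mem_eigSpace]
        intro a
        simp only [mul_sub, Finset.sum_sub_distrib, hf, ← Finset.sum_mul, hA]
        field_simp
        ring
      have hΦf : Φ (fun x => ∑ b, f (x, b), fun x => ⟨_, hmem x⟩) = f := by
        funext ⟨x, a⟩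
        simp [hΦ, ofFibreSum]
      refine ⟨⟨(fun x => ∑ b, f (x, b), fun x => ⟨_, hmem x⟩), ?_⟩, hΦf⟩
      rw [LinearMap.mem_ker, hT_iff, hΦf]
      exact fun x => rfl
  rw [gmult, ← hrange, LinearMap.finrank_range_of_inj hinj]

theorem finrank_fibreSumDefect_dom {V : Type*} [Fintype V] (A : Matrix W W ℂ) (μ : ℂ) :
    Module.finrank ℂ ((V → ℂ) × (V → A.eigSpace μ)) =
      Fintype.card V + Fintype.card V * A.gmult μ := by
  rw [Module.finrank_prod, Module.finrank_fintype_fun_eq_card, Module.finrank_pi_fintype]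
  simp [gmult]

/-- Orthogonality kills the sums of the h_x, so T acts as 1 − αE on `s` and ignores `h`. -/
theorem finrank_ker_fibreSumDefect_of_perp {D : Matrix V V ℂ} {A : Matrix W W ℂ} {μ α : ℂ}
    (hα : α ≠ 0) (hperp : A.EigSpacePerpOnes μ) :
    Module.finrank ℂ (fibreSumDefect (D + 2) A μ α).ker =
      Fintype.card V * A.gmult μ + D.gmult (α⁻¹ - 2) := by
  set T := fibreSumDefect (D + 2) A μ α with hT
  set S : (V → ℂ) →ₗ[ℂ] (V → ℂ) := T ∘ₗ LinearMap.inl ℂ _ _ with hS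
  have hsum : ∀ h : A.eigSpace μ, ∑ a, (h : W → ℂ) a = 0 := fun h => by
    simpa [dotProduct] using hperp h h.2
  have hTS : T = S ∘ₗ LinearMap.fst ℂ _ _ := by
    ext p x <;> simp [hS, hT, fibreSumDefect, hsum]
  have hker : S.ker = D.eigSpace (α⁻¹ - 2) := by
    ext s
    rw [LinearMap.mem_ker, mem_eigSpace, funext_iff]
    refine forall_congr' fun x => ?_
    have h2 : ∀ y, (2 : Matrix V V ℂ) x y = if x = y then 2 else 0 := fun y => diagonal_apply ..
    have : S s x = s x - α * (∑ y, D x y * s y + 2 * s x) := by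
      simp [hS, hT, fibreSumDefect, add_mul, Finset.sum_add_distrib, h2]
    rw [this, Pi.zero_apply]
    constructor
    · intro h
      field_simp
      linear_combination -h
    · intro h
      rw [h]
      field_simp
      ring
  have hrange : T.range = S.range := by
    rw [hTS, LinearMap.range_comp_of_range_eq_top _ (LinearMap.range_eq_top.2 LinearMap.fst_surjective)]
  have h1 := T.finrank_range_add_finrank_ker
  have h2 := S.finrank_range_add_finrank_ker
  rw [finrank_fibreSumDefect_dom, hrange] at h1
  rw [hker, Module.finrank_fintype_fun_eq_card] at h2
  rw [gmult] at *
  change _ = _ + Module.finrank ℂ (D.eigSpace (α⁻¹ - 2))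
  omega

/-- An eigenvector with nonzero sum, rescaled on each fibre, already makes the map surjective, so
the `s` summand adds nothing to the nullity. -/
theorem finrank_ker_fibreSumDefect_of_not_perp {V : Type*} [Fintype V] {E : Matrix V V ℂ}
    {A : Matrix W W ℂ} {μ α : ℂ}
    (hperp : ¬ A.EigSpacePerpOnes μ) :
    Module.finrank ℂ (fibreSumDefect E A μ α).ker = Fintype.card V * A.gmult μ := by
  simp only [EigSpacePerpOnes, not_forall] at hperp
  obtain ⟨v, hv, hne⟩ := hperp
  simp only [dotProduct, Pi.one_apply, mul_one] at hne
  have hsurj : (fibreSumDefect E A μ α).range = ⊤ := by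
    rw [LinearMap.range_eq_top]
    intro w
    refine ⟨(0, fun x => (-(w x / ∑ a, v a)) • ⟨v, hv⟩), ?_⟩
    funext x
    simp [fibreSumDefect, ← Finset.mul_sum, hne]
  have h1 := (fibreSumDefect E A μ α).finrank_range_add_finrank_ker
  rw [finrank_fibreSumDefect_dom, hsurj, finrank_top, Module.finrank_fintype_fun_eq_card] at h1
  omega

/-- The remaining eigenvalue, for which eigenvectors are constant on fibres. -/
theorem gmult_kronecker_sub_of_eq [Nonempty W] {D : Matrix V V ℂ} {A : Matrix W W ℂ} {r z : ℂ}
    (hA : ∀ a, ∑ b, A a b = r) (hz : -z - 2 = r)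
    (hconst : ∀ (u : W → ℂ) (c : ℂ), (∀ a, ∑ b, A a b * u b = r * u a + c) →
      ∀ a b, u a = u b) :
    ((D + 2) ⊗ₖ (of fun _ _ => (1 : ℂ)) - (1 : Matrix V V ℂ) ⊗ₖ (A + 2)).gmult z =
      D.gmult (-2) := by
  have hW : (Fintype.card W : ℂ) ≠ 0 := Nat.cast_ne_zero.2 Fintype.card_ne_zero
  have h2 : ∀ (x : V) (s : V → ℂ), ∑ y, (D + 2) x y * s y = ∑ y, D x y * s y + 2 * s x := by
    intro x s
    have h2 : ∀ y, (2 : Matrix V V ℂ) x y = if x = y then 2 else 0 := fun y => diagonal_apply ..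
    simp [add_mul, Finset.sum_add_distrib, h2]
  let Φ : (V → ℂ) →ₗ[ℂ] (V × W → ℂ) := LinearMap.funLeft ℂ ℂ Prod.fst
  have hinj : Function.Injective (Φ.domRestrict (D.eigSpace (-2))) :=
    (LinearMap.funLeft_injective_of_surjective ℂ ℂ _ Prod.fst_surjective).comp
      Subtype.val_injective
  have hrange : (Φ.domRestrict (D.eigSpace (-2))).range =
      ((D + 2) ⊗ₖ (of fun _ _ => (1 : ℂ)) - (1 : Matrix V V ℂ) ⊗ₖ (A + 2)).eigSpace z := by
    ext f
    rw [LinearMap.mem_range, mem_eigSpace_kronecker_sub, hz]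
    constructor
    · rintro ⟨⟨s, hs⟩, rfl⟩ x a
      have hs' := mem_eigSpace.1 hs x
      have h : ∑ y, (D + 2) x y * s y = 0 := by
        rw [h2, hs']
        ring
      simpa [Φ, LinearMap.funLeft_apply, ← Finset.sum_mul, hA,
        mul_left_comm _ (Fintype.card W : ℂ), ← Finset.mul_sum] using h
    · intro hf
      obtain ⟨a₀⟩ := ‹Nonempty W›
      have hc : ∀ x a, f (x, a) = f (x, a₀) := fun x a =>
        hconst (fun a => f (x, a)) _ (hf x) a a₀
      refine ⟨⟨fun x => f (x, a₀), mem_eigSpace.2 fun x => ?_⟩, ?_⟩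
      -- As f is constant on fibres, A acts on it as r, so the coupling term |W|·(D + 2)s must
      -- vanish.
      · have h := hf x a₀
        simp only [hc _ _, ← Finset.sum_mul, hA] at h
        simp only [Finset.sum_const, Finset.card_univ, nsmul_eq_mul] at h
        simp only [mul_left_comm _ (Fintype.card W : ℂ), ← Finset.mul_sum] at h
        rw [h2, left_eq_add] at h
        have := (mul_eq_zero.1 h).resolve_left hW
        linear_combination this
      · funext ⟨x, a⟩
        exact (hc x a).symm
  rw [gmult, ← hrange, LinearMap.finrank_range_of_inj hinj, gmult]

end Matrix

theorem mainTheorem6 {V W : Type*} [Fintype V] [DecidableEq V] [Fintype W] [DecidableEq W]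
    (Γ : Digraph V) (Γ' : Digraph W) (hΓ : Γ.Loopless) (hΓ' : Γ'.Loopless)
    (hconn : Γ.StronglyConnected) (hconn' : Γ'.StronglyConnected)
    (hdd : ∀ v, Γ.OnDoublyDirectedArc v)
    (r' : ℕ) (hreg : ∀ w, Γ'.outDegree w = r')
    (n n' : ℕ) (hn : Fintype.card V = n) (hn' : Fintype.card W = n') :
    -- the distance matrix of the product is meaningful
    (Γ.lexProduct Γ').StronglyConnected ∧
    -- `r'` is an eigenvalue of the adjacency matrix of `Γ'`; the other ones are what remains
    -- of the spectrum after one copy of `r'` is removed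
    (r' : ℂ) ∈ Γ'.adjMatrix.specMultiset ∧
    (Γ.lexProduct Γ').distMatrix.specMultiset =
      Γ.distMatrix.specMultiset.map (fun d => (n' : ℂ) * d + 2 * (n' : ℂ) - 2 - (r' : ℂ)) +
        n • (Γ'.adjMatrix.specMultiset.erase (r' : ℂ)).map (fun a => -(a + 2)) ∧
    ∀ z zt : ℂ, zt = (z - 2 * (n' : ℂ) + 2 + (r' : ℂ)) / (n' : ℂ) →
      ∀ g g' : ℕ, g = Γ.distMatrix.gmult zt → g' = Γ'.adjMatrix.gmult (-z - 2) →
        (¬ (-z - 2 ∈ Γ'.adjMatrix.specMultiset ∧ -z - 2 ≠ (r' : ℂ)) →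
          zt ∈ Γ.distMatrix.specMultiset →
            (Γ.lexProduct Γ').distMatrix.gmult z = g) ∧
        (-z - 2 ∈ Γ'.adjMatrix.specMultiset ∧ -z - 2 ≠ (r' : ℂ) →
          zt ∉ Γ.distMatrix.specMultiset →
            (Γ.lexProduct Γ').distMatrix.gmult z = n * g') ∧
        (-z - 2 ∈ Γ'.adjMatrix.specMultiset ∧ -z - 2 ≠ (r' : ℂ) →
          zt ∈ Γ.distMatrix.specMultiset →
          Γ'.adjMatrix.EigSpacePerpOnes (-z - 2) →
            (Γ.lexProduct Γ').distMatrix.gmult z = n * g' + g) ∧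
        (-z - 2 ∈ Γ'.adjMatrix.specMultiset ∧ -z - 2 ≠ (r' : ℂ) →
          zt ∈ Γ.distMatrix.specMultiset →
          ¬ Γ'.adjMatrix.EigSpacePerpOnes (-z - 2) →
            (Γ.lexProduct Γ').distMatrix.gmult z = n * g') ∧
        (¬ (-z - 2 ∈ Γ'.adjMatrix.specMultiset ∧ -z - 2 ≠ (r' : ℂ)) →
          zt ∉ Γ.distMatrix.specMultiset →
            (Γ.lexProduct Γ').distMatrix.gmult z = 0) 
:= by
  subst hn hn'
  have hW : Nonempty W := hconn'.1
  have hW0 : (Fintype.card W : ℂ) ≠ 0 := Nat.cast_ne_zero.2 Fintype.card_ne_zero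
  have hA := Digraph.sum_adjMatrix hreg
  have hr : (r' : ℂ) ∈ Γ'.adjMatrix.specMultiset := Matrix.mem_specMultiset_of_sum_eq hA
  rw [Digraph.distMatrix_lexProduct hΓ hΓ' hconn hdd]
  refine ⟨hconn.lexProduct hW hdd, hr, Matrix.specMultiset_kronecker_sub _ _ hA hr, ?_⟩
  rintro z zt hzt _ _ rfl rfl
  -- This is exactly the case `zt = -2`.
  by_cases hz : -z - 2 = r'
  · have hzt' : zt = -2 := by
      rw [hzt, ← hz]
      field_simp
      ring
    subst hzt'
    have h := Matrix.gmult_kronecker_sub_of_eq (D := Γ.distMatrix) hA hz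
      fun u c hu => Digraph.eq_of_sum_adjMatrix_mul_eq hconn' hreg hu
    exact ⟨fun _ _ => h, fun h' => absurd hz h'.2, fun h' => absurd hz h'.2,
      fun h' => absurd hz h'.2, fun _ h' => h.trans (Matrix.gmult_eq_zero h')⟩
  · have hβ : (r' : ℂ) - (-z - 2) ≠ 0 := sub_ne_zero.2 (Ne.symm hz)
    have hα : (Fintype.card W : ℂ) / (r' - (-z - 2)) ≠ 0 := div_ne_zero hW0 hβ
    have hzt' : ((Fintype.card W : ℂ) / (r' - (-z - 2)))⁻¹ - 2 = zt := by
      rw [hzt, inv_div]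
      field_simp
      ring
    have hperp : Γ'.adjMatrix.EigSpacePerpOnes (-z - 2) →
        (((Γ.distMatrix + 2) ⊗ₖ (Matrix.of fun _ _ => (1 : ℂ)) -
          (1 : Matrix V V ℂ) ⊗ₖ (Γ'.adjMatrix + 2)).gmult z =
        Fintype.card V * Γ'.adjMatrix.gmult (-z - 2) + Γ.distMatrix.gmult zt) := fun hp => by
      rw [Matrix.gmult_kronecker_sub_eq_finrank_ker hA hz,
        Matrix.finrank_ker_fibreSumDefect_of_perp hα hp, hzt']
    have hnperp : ¬ Γ'.adjMatrix.EigSpacePerpOnes (-z - 2) →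
        (((Γ.distMatrix + 2) ⊗ₖ (Matrix.of fun _ _ => (1 : ℂ)) -
          (1 : Matrix V V ℂ) ⊗ₖ (Γ'.adjMatrix + 2)).gmult z =
        Fintype.card V * Γ'.adjMatrix.gmult (-z - 2)) := fun hp => by
      rw [Matrix.gmult_kronecker_sub_eq_finrank_ker hA hz,
        Matrix.finrank_ker_fibreSumDefect_of_not_perp hp]
    have hnot : ¬ (-z - 2 ∈ Γ'.adjMatrix.specMultiset ∧ -z - 2 ≠ (r' : ℂ)) →
        (((Γ.distMatrix + 2) ⊗ₖ (Matrix.of fun _ _ => (1 : ℂ)) -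
          (1 : Matrix V V ℂ) ⊗ₖ (Γ'.adjMatrix + 2)).gmult z = Γ.distMatrix.gmult zt) := fun h => by
      have hmem : -z - 2 ∉ Γ'.adjMatrix.specMultiset := fun h' => h ⟨h', hz⟩
      -- A zero eigenspace is trivially orthogonal to 1.
      rw [hperp, Matrix.gmult_eq_zero hmem, mul_zero, zero_add]
      intro v hv
      rw [Matrix.eigSpace_eq_bot hmem, Submodule.mem_bot] at hv
      rw [hv, zero_dotProduct]
    refine ⟨fun h _ => hnot h, fun _ h => ?_, fun _ _ => hperp, fun _ _ => hnperp,
      fun h h' => (hnot h).trans (Matrix.gmult_eq_zero h')⟩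
    -- Here g = 0, so both formulas give the same value.
    by_cases hp : Γ'.adjMatrix.EigSpacePerpOnes (-z - 2)
    · rw [hperp hp, Matrix.gmult_eq_zero h, add_zero]
    · exact hnperp hp
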